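/- **Setting.** For $n$ points $P_1,\dots,P_n\in\mathbb R^3$, identify $\mathbb R^3$ with $\mathbb R\times\mathbb C$ and let $h:\mathbb C^2\to\mathbb R^3$, $h(z,w)=\big((|z|^2-|w|^2)/2,\ z\overline w\big)$, be the Hopf map. If the points are distinct, choose for all $i<j$ a pair $(z_{ij},w_{ij})$ with $h(z_{ij},w_{ij})=\overrightarrow{P_iP_j}$ and put $(z_{ji},w_{ji})=(-\overline{w_{ij}},\overline{z_{ij}})$, which is a lift of $\overrightarrow{P_jP_i}$. The Atiyah determinant $\mathrm{At}(P_1,\dots,P_n)$ is the determinant of the $n\times n$ matrix whose $j$-th column consists of the coefficients of $t^0,\dots,t^{n-1}$ in $\prod_{k\ne j}(z_{jk}+w_{jk}t)$; it does not depend on the choice of lifts. If the points are not distinct, $\mathrm{At}=0$ by convention. For $A,B,C,D\in\mathbb R^3$ let $U(A,B,C,D)=(a,b,c,x,y,z)=(|AD|,|BD|,|CD|,|AB|,|BC|,|AC|)\in\mathbb R^6$. Each permutation of the four points induces a permutation of the coordinates of $\mathbb R^6$; a polynomial on $\mathbb R^6$ is called symmetric (skew-symmetric) if it is invariant under these 24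 coordinate permutations (is multiplied by the sign of the permutation of the points). Let $$w_4=(a^2+y^2)(b-c-x+z)+(b^2+z^2)(-a+c+x-y)+(c^2+x^2)(a-b+y-z)+2(cx+yz)(-a+b)+2(ay+xz)(-b+c)+2(bz+xy)(a-c),$$ $$\begin{aligned}z_4={}&a^2y^2(b^2+c^2+x^2+z^2)+b^2z^2(a^2+c^2+x^2+y^2)+c^2x^2(a^2+b^2+y^2+z^2)\\&-(a^4y^2+a^2y^4+b^4z^2+b^2z^4+c^4x^2+c^2x^4)-(a^2b^2x^2+a^2c^2z^2+b^2c^2y^2+x^2y^2z^2).\end{aligned}$$ **Theorem.** 1. For all $A,B,C,D\in\mathbb R^3$, with $u=U(A,B,C,D)$, $$\big(\operatorname{Im}\mathrm{At}(A,B,C,D)\big)^2=w_4(u)^2\,z_4(u).$$ Moreover, $F_4=w_4^2z_4$ is the only real polynomial $F$ in six variables such that $(\operatorname{Im}\mathrm{At}(A,B,C,D))^2=F(U(A,B,C,D))$ for all $A,B,C,D\in\mathbb R^3$; it is symmetric and homogeneous of degree $12$. 2. $w_4$ is skew-symmetric and homogeneous of degree $3$. 3. For all $A,B,C,D\in\mathbb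 R^3$, $z_4(U(A,B,C,D))=144V^2$, where $V$ is the volume of the (possibly degenerate) tetrahedron with vertices $A,B,C,D$. 4. If the set $\{A,B,C,D\}$ is symmetric about a plane, then $\operatorname{Im}\mathrm{At}(A,B,C,D)=0$. -/

import Mathlib

open scoped ComplexConjugate

namespace FourPointAtiyah

/-- Euclidean three-space. -/
abbrev E3 : Type := EuclideanSpace ℝ (Fin 3)

/-! ### The Atiyah determinant -/

/-- The Hopf map `h(z, w) = ((|z|² - |w|²) / 2, z w̄)`, with `ℝ³` identified with `ℝ × ℂ` through
`v ↦ (v 0, v 1 + i v 2)`. -/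
noncomputable def hopf (p : ℂ × ℂ) : E3 :=
  !₂[(‖p.1‖ ^ 2 - ‖p.2‖ ^ 2) / 2, (p.1 * conj p.2).re, (p.1 * conj p.2).im]

/-- The map `(z, w) ↦ (-w̄, z̄)`, which turns a Hopf lift of `v` into a Hopf lift of `-v`. -/
noncomputable def antipode (p : ℂ × ℂ) : ℂ × ℂ := (-conj p.2, conj p.1)

/-- A normalized system of lifts for the points `P`: for `i ≠ j` the pair `ℓ i j` is a Hopf lift of
the vector from `P i` to `P j`, and if `i < j` and `ℓ i j = (z, w)`, then `ℓ j i = (-w̄, z̄)`. -/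
structure IsNormalizedLift {n : ℕ} (P : Fin n → E3) (ℓ : Fin n → Fin n → ℂ × ℂ) : Prop where
  hopf_eq : ∀ i j, i ≠ j → hopf (ℓ i j) = P j - P i
  antipode_eq : ∀ i j, i < j → ℓ j i = antipode (ℓ i j)

/-- The symmetric product of the lifts `ℓ j k = (z, w)`, `k ≠ j`, seen from the `j`-th point,
written as the polynomial `∏ (z + w t)`. -/
noncomputable def symProd {n : ℕ} (ℓ : Fin n → Fin n → ℂ × ℂ) (j : Fin n) : Polynomial ℂ :=
  ∏ k ∈ {j}ᶜ, (Polynomial.C (ℓ j k).1 + Polynomial.C (ℓ j k).2 * Polynomial.X)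

/-- The determinant of the matrix whose `j`-th column is the symmetric product of the lifts seen
from the `j`-th point. -/
noncomputable def liftDet {n : ℕ} (ℓ : Fin n → Fin n → ℂ × ℂ) : ℂ :=
  (Matrix.of fun m j : Fin n => (symProd ℓ j).coeff (m : ℕ)).det

open Classical in
/-- A concrete Hopf lift of a vector. -/
noncomputable def hopfLift (v : E3) : ℂ × ℂ :=
  if ‖v‖ + v 0 = 0 then (0, (Real.sqrt (2 * ‖v‖) : ℂ))
  else ((Real.sqrt (‖v‖ + v 0) : ℂ),
    (⟨v 1, -v 2⟩ : ℂ) / (Real.sqrt (‖v‖ + v 0) : ℂ))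

/-- A concrete normalized system of lifts. -/
noncomputable def stdLift {n : ℕ} (P : Fin n → E3) (i j : Fin n) : ℂ × ℂ :=
  if i < j then hopfLift (P j - P i) else antipode (hopfLift (P i - P j))

open Classical in
/-- The Atiyah determinant of `n` points of `ℝ³`; it is `0` by convention if the points are not
distinct. It can be computed from any normalized system of lifts, see `At_eq_liftDet`. -/
noncomputable def At {n : ℕ} (P : Fin n → E3) : ℂ :=
  if Function.Injective P then liftDet (stdLift P) else 0

theorem hopf_antipode (p : ℂ × ℂ) : hopf (antipode p) = -hopf p := by
  ext i
  fin_cases i <;> simp [hopf, antipode] <;> ring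

theorem hopf_hopfLift (v : E3) : hopf (hopfLift v) = v := by
  have hn : ‖v‖ ^ 2 = v 0 ^ 2 + v 1 ^ 2 + v 2 ^ 2 := by
    rw [EuclideanSpace.real_norm_sq_eq, Fin.sum_univ_three]
  have h0 : 0 ≤ ‖v‖ := norm_nonneg v
  have hpos : 0 ≤ ‖v‖ + v 0 := by
    nlinarith [sq_nonneg (v 1), sq_nonneg (v 2)]
  unfold hopfLift
  split_ifs with h
  · have e0 : v 0 = -‖v‖ := by linarith
    have e : v 1 ^ 2 + v 2 ^ 2 = 0 := by rw [e0] at hn; linarith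
    have e1 : v 1 = 0 := by nlinarith [sq_nonneg (v 1), sq_nonneg (v 2)]
    have e2 : v 2 = 0 := by nlinarith [sq_nonneg (v 1), sq_nonneg (v 2)]
    ext i
    fin_cases i
    · have hq : Real.sqrt (2 * ‖v‖) ^ 2 = 2 * ‖v‖ := Real.sq_sqrt (by positivity)
      simp only [hopf, norm_zero, Complex.norm_real, Real.norm_eq_abs, sq_abs, hq]
      simp [e0]
      ring
    · simp [hopf, e1]
    · simp [hopf, e2]
  · set s := Real.sqrt (‖v‖ + v 0) with hs
    have hs2 : s ^ 2 = ‖v‖ + v 0 := Real.sq_sqrt hpos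
    have hs0 : s ≠ 0 := by
      intro h'
      rw [h'] at hs2
      apply h
      linarith
    have hw : ‖(⟨v 1, -v 2⟩ : ℂ)‖ ^ 2 = v 1 ^ 2 + v 2 ^ 2 := by
      rw [Complex.sq_norm, Complex.normSq_mk]
      ring
    have hc : (s : ℂ) ≠ 0 := by exact_mod_cast hs0
    have hm : (s : ℂ) * conj ((⟨v 1, -v 2⟩ : ℂ) / (s : ℂ)) = ⟨v 1, v 2⟩ := by
      rw [map_div₀, Complex.conj_ofReal, mul_div_cancel₀ _ hc]
      apply Complex.ext <;> simp
    ext i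
    fin_cases i
    · simp only [hopf, norm_div, div_pow, hw]
      simp
      rw [hs2]
      have hd : ‖v‖ + v 0 ≠ 0 := h
      field_simp
      nlinarith
    · simpa [hopf] using congrArg Complex.re hm
    · simpa [hopf] using congrArg Complex.im hm

theorem isNormalizedLift_stdLift {n : ℕ} (P : Fin n → E3) : IsNormalizedLift P (stdLift P) where
  hopf_eq i j hij := by
    unfold stdLift
    split_ifs with h
    · exact hopf_hopfLift _
    · rw [hopf_antipode, hopf_hopfLift, neg_sub]
  antipode_eq i j hij := by
    simp [stdLift, hij, hij.not_gt]

/-- Two Hopf lifts of the same vector differ by a phase. -/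
theorem exists_phase {p q : ℂ × ℂ} (h : hopf p = hopf q) :
    ∃ c : ℂ, c * conj c = 1 ∧ q = (c * p.1, c * p.2) := by
  obtain ⟨z, w⟩ := p
  obtain ⟨z', w'⟩ := q
  have e0 : ‖z‖ ^ 2 - ‖w‖ ^ 2 = ‖z'‖ ^ 2 - ‖w'‖ ^ 2 := by
    have := congrArg (fun v : E3 => v 0) h
    simp [hopf] at this
    linarith
  have e1 : z * conj w = z' * conj w' := by
    apply Complex.ext
    · simpa [hopf] using congrArg (fun v : E3 => v 1) h
    · simpa [hopf] using congrArg (fun v : E3 => v 2) h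
  have e2 : ‖z‖ * ‖w‖ = ‖z'‖ * ‖w'‖ := by simpa using congrArg norm e1
  have e3 : ‖z‖ ^ 2 + ‖w‖ ^ 2 = ‖z'‖ ^ 2 + ‖w'‖ ^ 2 := by
    rw [← sq_eq_sq₀ (by positivity) (by positivity)]
    have e2' : (‖z‖ * ‖w‖) ^ 2 = (‖z'‖ * ‖w'‖) ^ 2 := by rw [e2]
    have e0' : (‖z‖ ^ 2 - ‖w‖ ^ 2) ^ 2 = (‖z'‖ ^ 2 - ‖w'‖ ^ 2) ^ 2 := by rw [e0]
    linear_combination e0' + 4 * e2'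
  have nz : ‖z‖ = ‖z'‖ := by
    rw [← sq_eq_sq₀ (by positivity) (by positivity)]
    linarith
  have nw : ‖w‖ = ‖w'‖ := by
    rw [← sq_eq_sq₀ (by positivity) (by positivity)]
    linarith
  have hunit : ∀ a b : ℂ, a ≠ 0 → ‖a‖ = ‖b‖ → (b / a) * conj (b / a) = 1 := by
    intro a b ha hab
    have : ‖a‖ ≠ 0 := norm_ne_zero_iff.mpr ha
    rw [Complex.mul_conj, Complex.normSq_eq_norm_sq, norm_div, ← hab, div_self this]
    simp
  by_cases hz : z = 0
  · have hz' : z' = 0 := by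
      rw [← norm_eq_zero, ← nz, hz, norm_zero]
    by_cases hw : w = 0
    · have hw' : w' = 0 := by
        rw [← norm_eq_zero, ← nw, hw, norm_zero]
      exact ⟨1, by simp, by simp [hz, hz', hw, hw']⟩
    · refine ⟨w' / w, hunit w w' hw nw, ?_⟩
      simp [hz, hz', hw]
  · refine ⟨z' / z, hunit z z' hz nz, ?_⟩
    have hz' : z' ≠ 0 := by
      intro h0
      apply hz
      rw [← norm_eq_zero, nz, h0, norm_zero]
    have key : z' * w = z * w' := by
      have e4 : conj z * w = conj z' * w' := by
        have := congrArg conj e1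
        simpa using this
      have e5 : z * conj z = z' * conj z' := by
        rw [Complex.mul_conj, Complex.mul_conj, Complex.normSq_eq_norm_sq,
          Complex.normSq_eq_norm_sq, nz]
      have hcz : conj z ≠ 0 := by simpa using hz
      apply mul_left_cancel₀ hcz
      linear_combination z' * e4 - w' * e5
    ext
    · simp [hz]
    · simp only
      field_simp
      linear_combination -key

/-- The determinant does not depend on the choice of the normalized system of lifts. -/
theorem liftDet_eq {n : ℕ} {P : Fin n → E3} {ℓ ℓ' : Fin n → Fin n → ℂ × ℂ}
    (h : IsNormalizedLift P ℓ) (h' : IsNormalizedLift P ℓ') : liftDet ℓ' = liftDet ℓ := by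
  have hc : ∀ i j : Fin n, ∃ c : ℂ, i < j →
      c * conj c = 1 ∧ ℓ' i j = (c * (ℓ i j).1, c * (ℓ i j).2) := by
    intro i j
    by_cases hij : i < j
    · obtain ⟨c, hc⟩ := exists_phase
        ((h.hopf_eq i j hij.ne).trans (h'.hopf_eq i j hij.ne).symm)
      exact ⟨c, fun _ => hc⟩
    · exact ⟨1, fun h => absurd h hij⟩
  choose c hc using hc
  let d : Fin n → Fin n → ℂ := fun i j => if i < j then c i j else conj (c j i)
  have hd : ∀ i j, j ≠ i → ℓ' i j = (d i j * (ℓ i j).1, d i j * (ℓ i j).2) := by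
    intro i j hij
    rcases lt_or_gt_of_ne hij with hlt | hlt
    · rw [h'.antipode_eq j i hlt, h.antipode_eq j i hlt, (hc j i hlt).2]
      simp [d, hlt.not_gt, antipode]
    · rw [(hc i j hlt).2]
      simp [d, hlt]
  have hcol : ∀ j, symProd ℓ' j = Polynomial.C (∏ k ∈ {j}ᶜ, d j k) * symProd ℓ j := by
    intro j
    rw [symProd, symProd, map_prod, ← Finset.prod_mul_distrib]
    refine Finset.prod_congr rfl fun k hk => ?_
    rw [hd j k (by simpa using hk)]
    simp only [map_mul]
    ring
  have hprod : ∏ j, ∏ k ∈ ({j}ᶜ : Finset (Fin n)), d j k = 1 := by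
    rw [← Finset.prod_prod_Ioi_mul_eq_prod_prod_off_diag (fun j k => d k j)]
    refine Finset.prod_eq_one fun i _ => Finset.prod_eq_one fun j hj => ?_
    have hij : i < j := by simpa using hj
    simpa [d, hij, hij.not_gt] using (hc i j hij).1
  have hmat : (Matrix.of fun m j : Fin n => (symProd ℓ' j).coeff (m : ℕ)) =
      Matrix.of fun m j : Fin n => (∏ k ∈ {j}ᶜ, d j k) *
        (Matrix.of fun m j : Fin n => (symProd ℓ j).coeff (m : ℕ)) m j := by
    ext m j
    simp only [Matrix.of_apply, hcol, Polynomial.coeff_C_mul]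
  rw [liftDet, hmat, Matrix.det_mul_row, hprod, one_mul, liftDet]

theorem At_eq_liftDet {n : ℕ} {P : Fin n → E3} (hP : Function.Injective P)
    {ℓ : Fin n → Fin n → ℂ × ℂ} (h : IsNormalizedLift P ℓ) : At P = liftDet ℓ := by
  rw [At, if_pos hP]
  exact liftDet_eq h (isNormalizedLift_stdLift P)

/-! ### The vector of pairwise distances and the polynomials -/

/-- The vector `(a, b, c, x, y, z) = (AD, BD, CD, AB, BC, AC)` of pairwise distances of the four
points `A = P 0`, `B = P 1`, `C = P 2`, `D = P 3`. -/
noncomputable def distVec (P : Fin 4 → E3) : Fin 6 → ℝ :=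
  ![dist (P 0) (P 3), dist (P 1) (P 3), dist (P 2) (P 3),
    dist (P 0) (P 1), dist (P 1) (P 2), dist (P 0) (P 2)]

/-- The position in `(a, b, c, x, y, z)` of the distance between two of the four points (the values
on the diagonal are irrelevant). -/
def edgeIdx : Fin 4 → Fin 4 → Fin 6 :=
  ![![0, 3, 5, 0],
    ![3, 0, 4, 1],
    ![5, 4, 0, 2],
    ![0, 1, 2, 0]]

/-- The permutation of the coordinates `(a, b, c, x, y, z)` of an arbitrary vector of `ℝ⁶` that
results from a permutation of the four points. -/
def permuteVec (σ : Equiv.Perm (Fin 4)) (u : Fin 6 → ℝ) : Fin 6 → ℝ :=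
  ![u (edgeIdx (σ 0) (σ 3)), u (edgeIdx (σ 1) (σ 3)), u (edgeIdx (σ 2) (σ 3)),
    u (edgeIdx (σ 0) (σ 1)), u (edgeIdx (σ 1) (σ 2)), u (edgeIdx (σ 0) (σ 2))]

theorem distVec_edgeIdx (P : Fin 4 → E3) {i j : Fin 4} (h : i ≠ j) :
    distVec P (edgeIdx i j) = dist (P i) (P j) := by
  fin_cases i <;> fin_cases j <;> first | exact absurd rfl h | rfl | exact dist_comm _ _

theorem distVec_comp_perm (P : Fin 4 → E3) (σ : Equiv.Perm (Fin 4)) :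
    distVec (P ∘ σ) = permuteVec σ (distVec P) := by
  have h : ∀ i j : Fin 4, i ≠ j →
      distVec P (edgeIdx (σ i) (σ j)) = dist (P (σ i)) (P (σ j)) := fun i j hij =>
    distVec_edgeIdx P (σ.injective.ne hij)
  rw [permuteVec, h 0 3 (by decide), h 1 3 (by decide), h 2 3 (by decide), h 0 1 (by decide),
    h 1 2 (by decide), h 0 2 (by decide)]
  rfl

/-- A polynomial in `(a, b, c, x, y, z)` is symmetric if, as a function on `ℝ⁶`, it is invariant
under the permutations of the coordinates that result from permutations of the four points. -/
def IsSymmPoly (f : MvPolynomial (Fin 6) ℝ) : Prop :=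
  ∀ (σ : Equiv.Perm (Fin 4)) (u : Fin 6 → ℝ),
    MvPolynomial.eval (permuteVec σ u) f = MvPolynomial.eval u f

/-- A polynomial in `(a, b, c, x, y, z)` is skew-symmetric if, as a function on `ℝ⁶`, it is
multiplied by the sign of the permutation under those permutations of the coordinates. -/
def IsSkewPoly (f : MvPolynomial (Fin 6) ℝ) : Prop :=
  ∀ (σ : Equiv.Perm (Fin 4)) (u : Fin 6 → ℝ),
    MvPolynomial.eval (permuteVec σ u) f = ((Equiv.Perm.sign σ : ℤ) : ℝ) * MvPolynomial.eval u f

/-- The cubic `w₄` in the variables `(a, b, c, x, y, z)`. -/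
noncomputable def w4 : MvPolynomial (Fin 6) ℝ :=
  let a := MvPolynomial.X 0
  let b := MvPolynomial.X 1
  let c := MvPolynomial.X 2
  let x := MvPolynomial.X 3
  let y := MvPolynomial.X 4
  let z := MvPolynomial.X 5
  (a ^ 2 + y ^ 2) * (b - c - x + z) + (b ^ 2 + z ^ 2) * (-a + c + x - y)
    + (c ^ 2 + x ^ 2) * (a - b + y - z)
    + 2 * (c * x + y * z) * (-a + b) + 2 * (a * y + x * z) * (-b + c)
    + 2 * (b * z + x * y) * (a - c)

/-- The sextic `z₄` in the variables `(a, b, c, x, y, z)`. -/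
noncomputable def z4 : MvPolynomial (Fin 6) ℝ :=
  let a := MvPolynomial.X 0
  let b := MvPolynomial.X 1
  let c := MvPolynomial.X 2
  let x := MvPolynomial.X 3
  let y := MvPolynomial.X 4
  let z := MvPolynomial.X 5
  a ^ 2 * y ^ 2 * (b ^ 2 + c ^ 2 + x ^ 2 + z ^ 2)
    + b ^ 2 * z ^ 2 * (a ^ 2 + c ^ 2 + x ^ 2 + y ^ 2)
    + c ^ 2 * x ^ 2 * (a ^ 2 + b ^ 2 + y ^ 2 + z ^ 2)
    - (a ^ 4 * y ^ 2 + a ^ 2 * y ^ 4 + b ^ 4 * z ^ 2 + b ^ 2 * z ^ 4 + c ^ 4 * x ^ 2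
      + c ^ 2 * x ^ 4)
    - (a ^ 2 * b ^ 2 * x ^ 2 + a ^ 2 * c ^ 2 * z ^ 2 + b ^ 2 * c ^ 2 * y ^ 2
      + x ^ 2 * y ^ 2 * z ^ 2)

/-- The volume of the tetrahedron with the four given vertices. -/
noncomputable def tetVolume (P : Fin 4 → E3) : ℝ :=
  MeasureTheory.volume.real (convexHull ℝ (Set.range P))

end FourPointAtiyah

open FourPointAtiyah

namespace FourPointAtiyah

/-! An edge enters two columns of the matrix, through its lift (z, w) and through the antipodal lift
(-w̄, z̄). So the determinant is a polynomial in the products |z|², |w|², z w̄, w z̄ of the six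
edges. These are determined by the edge vector: |z|² and |w|² are its length plus and minus its
first coordinate, z w̄ is its complex coordinate, and w z̄ is the conjugate of z w̄.

Complex conjugation therefore only swaps z w̄ with w z̄. The part of the polynomial that is odd
under this swap factors as the determinant T of the three edge vectors at the first point times w₄
(`edgeForm_sub_edgeForm_swap`), whence Im At = -2 T w₄(u) (`At_im`). The square formula follows from
the Cayley–Menger identity z₄(u) = 4T², and z₄(u) = 144V² from V = |T|/6 (`tetVolume_eq`).

Uniqueness holds because the distance vectors contain a box with nonempty interior
(`exists_distVec_eq`). For a planar symmetry, the reflection preserves distances and negates T,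
while the relabelling it induces multiplies both T and w₄ by the same sign; hence T w₄ = -T w₄. -/

open MeasureTheory

/-! ### The determinant as a form in the edge products -/

/-- The determinant of the four products of linear forms, as a function of the products `z z'`,
`w w'`, `z w'`, `w z'` of the coefficients of the
two forms `z + w t`, `-w' + z' t` that belong to an edge. -/
def edgeForm {R : Type*} [CommRing R]
    (p12 q12 m12 n12 p13 q13 m13 n13 p14 q14 m14 n14 p23 q23 m23 n23 p24 q24 m24 n24 p34 q34 m34 n34
    : R) : R :=
    p12 * p13 * p14 * (p23 * p24 * p34 - m23 * p24 * n34 + p23 * p24 * q34 + p23 * m24 * n34 +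
      q23 * p24 * p34 + m23 * n24 * p34 + n23 * m24 * q34 + p23 * q24 * q34 + q23 * n24 * m34 +
      q23 * q24 * p34 - n23 * q24 * m34 + q23 * q24 * q34)
    - p12 * m13 * p14 * (p23 * p24 * n34 - n23 * p24 * p34 + q23 * p24 * n34 - p23 * n24 * p34 +
      m23 * n24 * n34 - n23 * n24 * m34 - n23 * q24 * p34 + q23 * n24 * q34 + q23 * q24 * n34 -
      n23 * q24 * q34)
    - m12 * p13 * p14 * (n23 * p24 * p34 - q23 * p24 * n34 + p23 * n24 * p34 - m23 * n24 * n34 +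
      n23 * p24 * q34 + n23 * m24 * n34 + p23 * n24 * q34 + p23 * q24 * n34 + q23 * n24 * p34 +
      n23 * q24 * q34)
    + m12 * m13 * p14 * (n23 * p24 * n34 + p23 * n24 * n34 - n23 * n24 * p34 + q23 * n24 * n34)
    + p12 * p13 * m14 * (p23 * p24 * n34 + n23 * p24 * q34 + n23 * m24 * n34 + p23 * n24 * q34 +
      p23 * q24 * n34 + q23 * n24 * p34 - n23 * n24 * m34 - n23 * q24 * p34 + q23 * n24 * q34 +
      q23 * q24 * n34)
    - m12 * p13 * m14 * (n23 * p24 * n34 + p23 * n24 * n34 + n23 * n24 * q34 + n23 * q24 * n34)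
    + p12 * m13 * m14 * (n23 * n24 * p34 - q23 * n24 * n34 + n23 * n24 * q34 + n23 * q24 * n34)
    + q12 * p13 * p14 * (p23 * p24 * p34 - m23 * p24 * n34 + p23 * p24 * q34 + p23 * m24 * n34)
    - q12 * m13 * p14 * (p23 * p24 * n34 + q23 * n24 * p34)
    + m12 * n13 * p14 * (p23 * p24 * p34 - m23 * p24 * n34 + p23 * p24 * q34 + p23 * m24 * n34)
    - m12 * q13 * p14 * (p23 * p24 * n34 + q23 * n24 * p34)
    + m12 * p13 * n14 * (p23 * p24 * p34 - m23 * p24 * n34 + p23 * p24 * q34 + p23 * m24 * n34)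
    - m12 * m13 * n14 * (p23 * p24 * n34 + q23 * n24 * p34)
    + q12 * p13 * m14 * (p23 * p24 * n34 - n23 * q24 * q34)
    + m12 * n13 * m14 * (p23 * p24 * n34 - n23 * q24 * q34)
    + m12 * p13 * q14 * (p23 * p24 * n34 - n23 * q24 * q34)
    + n12 * m13 * p14 * (q23 * p24 * p34 + m23 * n24 * p34 + q23 * n24 * m34 + q23 * q24 * p34)
    + p12 * q13 * p14 * (q23 * p24 * p34 + m23 * n24 * p34 + q23 * n24 * m34 + q23 * q24 * p34)
    + p12 * m13 * n14 * (q23 * p24 * p34 + m23 * n24 * p34 + q23 * n24 * m34 + q23 * q24 * p34)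
    + n12 * p13 * m14 * (n23 * m24 * q34 + p23 * q24 * q34 - n23 * q24 * m34 + q23 * q24 * q34)
    + p12 * n13 * m14 * (n23 * m24 * q34 + p23 * q24 * q34 - n23 * q24 * m34 + q23 * q24 * q34)
    + p12 * p13 * q14 * (n23 * m24 * q34 + p23 * q24 * q34 - n23 * q24 * m34 + q23 * q24 * q34)
    + n12 * m13 * m14 * (q23 * n24 * p34 + n23 * q24 * q34)
    + p12 * q13 * m14 * (q23 * n24 * p34 + n23 * q24 * q34)
    + p12 * m13 * q14 * (q23 * n24 * p34 + n23 * q24 * q34)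
    + q12 * n13 * p14 * (m23 * p24 * p34 + p23 * m24 * q34)
    + q12 * q13 * p14 * (p23 * p24 * p34 - m23 * p24 * n34 + q23 * p24 * p34 + m23 * n24 * p34)
    + q12 * p13 * n14 * (m23 * p24 * p34 + p23 * m24 * q34)
    + q12 * m13 * n14 * (p23 * p24 * p34 - m23 * p24 * n34 + q23 * p24 * p34 + m23 * n24 * p34)
    + m12 * n13 * n14 * (m23 * p24 * p34 + p23 * m24 * q34)
    + m12 * q13 * n14 * (p23 * p24 * p34 - m23 * p24 * n34 + q23 * p24 * p34 + m23 * n24 * p34)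
    + q12 * n13 * m14 * (p23 * p24 * q34 + p23 * m24 * n34 + n23 * m24 * q34 + p23 * q24 * q34)
    + q12 * p13 * q14 * (p23 * p24 * q34 + p23 * m24 * n34 + n23 * m24 * q34 + p23 * q24 * q34)
    + m12 * n13 * q14 * (p23 * p24 * q34 + p23 * m24 * n34 + n23 * m24 * q34 + p23 * q24 * q34)
    - n12 * q13 * p14 * (m23 * p24 * p34 - q23 * q24 * m34)
    - n12 * m13 * n14 * (m23 * p24 * p34 - q23 * q24 * m34)
    - p12 * q13 * n14 * (m23 * p24 * p34 - q23 * q24 * m34)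
    - n12 * n13 * m14 * (p23 * m24 * q34 + q23 * q24 * m34)
    - n12 * p13 * q14 * (p23 * m24 * q34 + q23 * q24 * m34)
    - p12 * n13 * q14 * (p23 * m24 * q34 + q23 * q24 * m34)
    + n12 * q13 * m14 * (q23 * n24 * m34 + q23 * q24 * p34 - n23 * q24 * m34 + q23 * q24 * q34)
    + n12 * m13 * q14 * (q23 * n24 * m34 + q23 * q24 * p34 - n23 * q24 * m34 + q23 * q24 * q34)
    + p12 * q13 * q14 * (q23 * n24 * m34 + q23 * q24 * p34 - n23 * q24 * m34 + q23 * q24 * q34)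
    + q12 * n13 * n14 * (m23 * p24 * m34 + m23 * m24 * p34 - p23 * m24 * m34 + m23 * m24 * q34)
    + q12 * n13 * q14 * (m23 * p24 * p34 - p23 * p24 * m34 - p23 * m24 * p34 + m23 * p24 * q34 +
      m23 * m24 * n34 - n23 * m24 * m34 + q23 * m24 * q34 - p23 * q24 * m34 + m23 * q24 * q34 -
      q23 * q24 * m34)
    + q12 * q13 * n14 * (p23 * p24 * m34 + p23 * m24 * p34 - m23 * p24 * q34 - m23 * m24 * n34 +
      p23 * m24 * q34 + q23 * p24 * m34 + q23 * m24 * p34 + m23 * n24 * m34 + m23 * q24 * p34 +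
      q23 * q24 * m34)
    + q12 * q13 * q14 * (p23 * p24 * p34 - m23 * p24 * n34 + p23 * p24 * q34 + p23 * m24 * n34 +
      q23 * p24 * p34 + m23 * n24 * p34 + n23 * m24 * q34 + p23 * q24 * q34 + q23 * n24 * m34 +
      q23 * q24 * p34 - n23 * q24 * m34 + q23 * q24 * q34)
    - n12 * q13 * n14 * (m23 * p24 * m34 + m23 * m24 * p34 + q23 * m24 * m34 + m23 * q24 * m34)
    - n12 * q13 * q14 * (m23 * p24 * p34 + p23 * m24 * q34 + q23 * p24 * m34 + q23 * m24 * p34 +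
      m23 * n24 * m34 + m23 * q24 * p34 - n23 * m24 * m34 + q23 * m24 * q34 - p23 * q24 * m34 +
      m23 * q24 * q34)
    + n12 * n13 * q14 * (p23 * m24 * m34 - m23 * m24 * q34 + q23 * m24 * m34 + m23 * q24 * m34)

/-- The coefficients of `(z₁ + w₁ t) (z₂ + w₂ t) (z₃ + w₃ t)`. -/
def cubicCoeff {R : Type*} [CommRing R] (z₁ w₁ z₂ w₂ z₃ w₃ : R) : Fin 4 → R :=
  ![z₁ * z₂ * z₃, w₁ * z₂ * z₃ + z₁ * w₂ * z₃ + z₁ * z₂ * w₃,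
    w₁ * w₂ * z₃ + w₁ * z₂ * w₃ + z₁ * w₂ * w₃, w₁ * w₂ * w₃]

/-- The determinant is linear in each of (z, w) and (z', w') of every edge, so each monomial
contains exactly one of the four products per edge. The primed letters are free variables here; they
become the conjugates of the unprimed ones for actual lifts. -/
theorem det_cubicCoeff {R : Type*} [CommRing R]
    (z12 w12 z12' w12' z13 w13 z13' w13' z14 w14 z14' w14' z23 w23 z23' w23' z24 w24 z24' w24' z34
    w34 z34' w34' : R) :
    (Matrix.of fun m j : Fin 4 =>
      ![cubicCoeff z12 w12 z13 w13 z14 w14,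
        cubicCoeff (-w12') z12' z23 w23 z24 w24,
        cubicCoeff (-w13') z13' (-w23') z23' z34 w34,
        cubicCoeff (-w14') z14' (-w24') z24' (-w34') z34'] j m).det =
    edgeForm (z12 * z12') (w12 * w12') (z12 * w12') (w12 * z12') (z13 * z13') (w13 * w13')
      (z13 * w13') (w13 * z13') (z14 * z14') (w14 * w14') (z14 * w14') (w14 * z14') (z23 * z23')
      (w23 * w23') (z23 * w23') (w23 * z23') (z24 * z24') (w24 * w24') (z24 * w24') (w24 * z24')
      (z34 * z34') (w34 * w34') (z34 * w34') (w34 * z34') := by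
  rw [Matrix.det_succ_row_zero]
  simp only [Fin.sum_univ_succ, Matrix.det_fin_three, Matrix.submatrix_apply, Matrix.of_apply,
    cubicCoeff, edgeForm]
  simp [Fin.succAbove, -mul_neg, -neg_mul]
  ring

/-- The algebraic core. The triples (tᵢ, mᵢ, nᵢ) are the edges from the first point, and their
differences are the other three edges. Without any relation on the lengths, the left side is twice
the 3×3 determinant times w₄ with each squared length replaced by its expression t² + mn; the
hypotheses serve only to restore the squares. -/
theorem edgeForm_sub_edgeForm_swap {R : Type*} [CommRing R] {t₁ t₂ t₃ m₁ m₂ m₃ n₁ n₂ n₃ a b c x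
    y z : R}
    (hx : x ^ 2 = t₁ ^ 2 + m₁ * n₁) (hz : z ^ 2 = t₂ ^ 2 + m₂ * n₂) (ha : a ^ 2 = t₃ ^ 2 + m₃ * n₃)
    (hy : y ^ 2 = (t₂ - t₁) ^ 2 + (m₂ - m₁) * (n₂ - n₁)) (hb : b ^ 2 = (t₃ - t₁) ^ 2 + (m₃ - m₁) *
    (n₃ - n₁)) (hc : c ^ 2 = (t₃ - t₂) ^ 2 + (m₃ - m₂) * (n₃ - n₂)) :
    edgeForm (x + t₁) (x - t₁) m₁ n₁ (z + t₂) (z - t₂) m₂ n₂ (a + t₃) (a - t₃) m₃ n₃ (y +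
      (t₂ - t₁)) (y - (t₂ - t₁)) (m₂ - m₁) (n₂ - n₁) (b + (t₃ - t₁)) (b - (t₃ - t₁)) (m₃ - m₁)
      (n₃ - n₁) (c + (t₃ - t₂)) (c - (t₃ - t₂)) (m₃ - m₂) (n₃ - n₂) -
      edgeForm (x + t₁) (x - t₁) n₁ m₁ (z + t₂) (z - t₂) n₂ m₂ (a + t₃) (a - t₃) n₃ m₃ (y +
        (t₂ - t₁)) (y - (t₂ - t₁)) (n₂ - n₁) (m₂ - m₁) (b + (t₃ - t₁)) (b - (t₃ - t₁)) (n₃ - n₁)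
        (m₃ - m₁) (c + (t₃ - t₂)) (c - (t₃ - t₂)) (n₃ - n₂) (m₃ - m₂) =
    2 * (t₁ * (m₂ * n₃ - m₃ * n₂) - t₂ * (m₁ * n₃ - m₃ * n₁) + t₃ * (m₁ * n₂ - m₂ * n₁)) *
      ((a ^ 2 + y ^ 2) * (b - c - x + z) + (b ^ 2 + z ^ 2) * (-a + c + x - y)
        + (c ^ 2 + x ^ 2) * (a - b + y - z)
        + 2 * (c * x + y * z) * (-a + b) + 2 * (a * y + x * z) * (-b + c)
        + 2 * (b * z + x * y) * (a - c)) := by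
  simp only [edgeForm]
  linear_combination (-2 * (t₁ * (m₂ * n₃ - m₃ * n₂) - t₂ * (m₁ * n₃ - m₃ * n₁) + t₃ *
    (m₁ * n₂ - m₂ * n₁))) *
    ((b - c - x + z) * (ha + hy) + (-a + c + x - y) * (hb + hz) + (a - b + y - z) * (hc + hx))

/-! ### Signed volume and the imaginary part -/

/-- Six times the signed volume of the tetrahedron with vertices `P 0`, `P 1`, `P 2`, `P 3`. -/
noncomputable def edgeDet (P : Fin 4 → E3) : ℝ :=
  (Matrix.of fun i k : Fin 3 => (P i.succ - P 0) k).det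

theorem edgeDet_eq (P : Fin 4 → E3) :
    edgeDet P =
      (P 1 0 - P 0 0) * ((P 2 1 - P 0 1) * (P 3 2 - P 0 2) - (P 3 1 - P 0 1) * (P 2 2 - P 0 2))
      - (P 2 0 - P 0 0) * ((P 1 1 - P 0 1) * (P 3 2 - P 0 2) - (P 3 1 - P 0 1) * (P 1 2 - P 0 2))
      + (P 3 0 - P 0 0) *
        ((P 1 1 - P 0 1) * (P 2 2 - P 0 2) - (P 2 1 - P 0 1) * (P 1 2 - P 0 2)) := by
  rw [edgeDet, Matrix.det_fin_three]
  simp only [Matrix.of_apply, Fin.succ_zero_eq_one, Fin.succ_one_eq_two,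
    show (2 : Fin 3).succ = 3 from rfl, PiLp.sub_apply]
  ring

theorem dist_sq_eq (u v : E3) :
    dist u v ^ 2 = (v 0 - u 0) ^ 2 + (v 1 - u 1) ^ 2 + (v 2 - u 2) ^ 2 := by
  rw [dist_comm, dist_eq_norm, EuclideanSpace.real_norm_sq_eq, Fin.sum_univ_three]
  simp

/-- The entries of the Hermitian matrix of a Hopf lift in terms of the lifted vector. -/
theorem hopf_entries {p : ℂ × ℂ} {u v : E3} (h : hopf p = v - u) :
    p.1 * conj p.1 = (dist u v : ℂ) + ((v 0 : ℂ) - u 0) ∧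
    p.2 * conj p.2 = (dist u v : ℂ) - ((v 0 : ℂ) - u 0) ∧
    p.1 * conj p.2 = ⟨v 1, v 2⟩ - ⟨u 1, u 2⟩ ∧
    p.2 * conj p.1 = ⟨v 1, -v 2⟩ - ⟨u 1, -u 2⟩ := by
  obtain ⟨z, w⟩ := p
  have h0 : (‖z‖ ^ 2 - ‖w‖ ^ 2) / 2 = v 0 - u 0 := by
    simpa [hopf] using congrArg (fun x : E3 => x 0) h
  have h1 : (z * conj w).re = v 1 - u 1 := by
    simpa [hopf] using congrArg (fun x : E3 => x 1) h
  have h2 : (z * conj w).im = v 2 - u 2 := by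
    simpa [hopf] using congrArg (fun x : E3 => x 2) h
  -- Together with ((|z|² - |w|²)/2)² + (|z||w|)² = ((|z|² + |w|²)/2)², this shows that the lifted
  -- vector has length (|z|² + |w|²)/2.
  have hm : (‖z‖ * ‖w‖) ^ 2 = (v 1 - u 1) ^ 2 + (v 2 - u 2) ^ 2 := by
    rw [← h1, ← h2, ← Complex.norm_conj w, ← norm_mul, Complex.sq_norm, Complex.normSq_apply]
    ring
  have hd : dist u v = (‖z‖ ^ 2 + ‖w‖ ^ 2) / 2 := by
    rw [← sq_eq_sq₀ dist_nonneg (by positivity), dist_sq_eq]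
    rw [← h0]
    linear_combination -hm
  refine ⟨?_, ?_, ?_, ?_⟩
  · rw [Complex.mul_conj, Complex.normSq_eq_norm_sq, hd, ← Complex.ofReal_sub, ← h0]
    push_cast
    ring
  · rw [Complex.mul_conj, Complex.normSq_eq_norm_sq, hd, ← Complex.ofReal_sub, ← h0]
    push_cast
    ring
  · exact Complex.ext h1 h2
  · rw [show w * conj z = conj (z * conj w) by simp [mul_comm]]
    refine Complex.ext ?_ ?_
    · simpa using h1
    · rw [Complex.conj_im, h2, Complex.sub_im]
      ring

theorem coeff_linear_mul_linear_mul_linear {R : Type*} [CommRing R] (p q r : R × R) (m : Fin 4) :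
    ((Polynomial.C p.1 + Polynomial.C p.2 * Polynomial.X) *
      ((Polynomial.C q.1 + Polynomial.C q.2 * Polynomial.X) *
        (Polynomial.C r.1 + Polynomial.C r.2 * Polynomial.X))).coeff (m : ℕ) =
      cubicCoeff p.1 p.2 q.1 q.2 r.1 r.2 m := by
  have h : (Polynomial.C p.1 + Polynomial.C p.2 * Polynomial.X) *
      ((Polynomial.C q.1 + Polynomial.C q.2 * Polynomial.X) *
        (Polynomial.C r.1 + Polynomial.C r.2 * Polynomial.X)) =
      Polynomial.C (cubicCoeff p.1 p.2 q.1 q.2 r.1 r.2 0) +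
      Polynomial.C (cubicCoeff p.1 p.2 q.1 q.2 r.1 r.2 1) * Polynomial.X +
      Polynomial.C (cubicCoeff p.1 p.2 q.1 q.2 r.1 r.2 2) * Polynomial.X ^ 2 +
      Polynomial.C (cubicCoeff p.1 p.2 q.1 q.2 r.1 r.2 3) * Polynomial.X ^ 3 := by
    simp only [cubicCoeff, Matrix.cons_val, map_add, map_mul]
    ring
  rw [h]
  fin_cases m <;>
    simp [Polynomial.coeff_X, Polynomial.coeff_X_pow, Polynomial.coeff_C]

theorem symProd_coeff (ℓ : Fin 4 → Fin 4 → ℂ × ℂ) (m j : Fin 4) :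
    (symProd ℓ j).coeff (m : ℕ) =
      ![cubicCoeff (ℓ 0 1).1 (ℓ 0 1).2 (ℓ 0 2).1 (ℓ 0 2).2 (ℓ 0 3).1 (ℓ 0 3).2,
        cubicCoeff (ℓ 1 0).1 (ℓ 1 0).2 (ℓ 1 2).1 (ℓ 1 2).2 (ℓ 1 3).1 (ℓ 1 3).2,
        cubicCoeff (ℓ 2 0).1 (ℓ 2 0).2 (ℓ 2 1).1 (ℓ 2 1).2 (ℓ 2 3).1 (ℓ 2 3).2,
        cubicCoeff (ℓ 3 0).1 (ℓ 3 0).2 (ℓ 3 1).1 (ℓ 3 1).2 (ℓ 3 2).1 (ℓ 3 2).2] j m := by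
  have h0 : ({0}ᶜ : Finset (Fin 4)) = {1, 2, 3} := by decide
  have h1 : ({1}ᶜ : Finset (Fin 4)) = {0, 2, 3} := by decide
  have h2 : ({2}ᶜ : Finset (Fin 4)) = {0, 1, 3} := by decide
  have h3 : ({3}ᶜ : Finset (Fin 4)) = {0, 1, 2} := by decide
  have hprod (f : Fin 4 → Polynomial ℂ) {i j k : Fin 4} (hij : i ≠ j) (hik : i ≠ k)
      (hjk : j ≠ k) : ∏ l ∈ {i, j, k}, f l = f i * (f j * f k) := by
    rw [Finset.prod_insert (by simp [hij, hik]), Finset.prod_pair hjk]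
  unfold symProd
  fin_cases j
  · change Polynomial.coeff (∏ k ∈ ({0}ᶜ : Finset (Fin 4)), _) _ = _
    rw [h0, hprod _ (by decide) (by decide) (by decide)]
    exact coeff_linear_mul_linear_mul_linear _ _ _ m
  · change Polynomial.coeff (∏ k ∈ ({1}ᶜ : Finset (Fin 4)), _) _ = _
    rw [h1, hprod _ (by decide) (by decide) (by decide)]
    exact coeff_linear_mul_linear_mul_linear _ _ _ m
  · change Polynomial.coeff (∏ k ∈ ({2}ᶜ : Finset (Fin 4)), _) _ = _
    rw [h2, hprod _ (by decide) (by decide) (by decide)]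
    exact coeff_linear_mul_linear_mul_linear _ _ _ m
  · change Polynomial.coeff (∏ k ∈ ({3}ᶜ : Finset (Fin 4)), _) _ = _
    rw [h3, hprod _ (by decide) (by decide) (by decide)]
    exact coeff_linear_mul_linear_mul_linear _ _ _ m

theorem liftDet_eq_edgeForm {P : Fin 4 → E3} {ℓ : Fin 4 → Fin 4 → ℂ × ℂ}
    (h : IsNormalizedLift P ℓ) :
    liftDet ℓ = edgeForm
      ((ℓ 0 1).1 * conj (ℓ 0 1).1) ((ℓ 0 1).2 * conj (ℓ 0 1).2)
      ((ℓ 0 1).1 * conj (ℓ 0 1).2) ((ℓ 0 1).2 * conj (ℓ 0 1).1)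
      ((ℓ 0 2).1 * conj (ℓ 0 2).1) ((ℓ 0 2).2 * conj (ℓ 0 2).2)
      ((ℓ 0 2).1 * conj (ℓ 0 2).2) ((ℓ 0 2).2 * conj (ℓ 0 2).1)
      ((ℓ 0 3).1 * conj (ℓ 0 3).1) ((ℓ 0 3).2 * conj (ℓ 0 3).2)
      ((ℓ 0 3).1 * conj (ℓ 0 3).2) ((ℓ 0 3).2 * conj (ℓ 0 3).1)
      ((ℓ 1 2).1 * conj (ℓ 1 2).1) ((ℓ 1 2).2 * conj (ℓ 1 2).2)
      ((ℓ 1 2).1 * conj (ℓ 1 2).2) ((ℓ 1 2).2 * conj (ℓ 1 2).1)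
      ((ℓ 1 3).1 * conj (ℓ 1 3).1) ((ℓ 1 3).2 * conj (ℓ 1 3).2)
      ((ℓ 1 3).1 * conj (ℓ 1 3).2) ((ℓ 1 3).2 * conj (ℓ 1 3).1)
      ((ℓ 2 3).1 * conj (ℓ 2 3).1) ((ℓ 2 3).2 * conj (ℓ 2 3).2)
      ((ℓ 2 3).1 * conj (ℓ 2 3).2) ((ℓ 2 3).2 * conj (ℓ 2 3).1) := by
  rw [← det_cubicCoeff, liftDet]
  simp only [symProd_coeff, h.antipode_eq 0 1 (by decide), h.antipode_eq 0 2 (by decide),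
    h.antipode_eq 0 3 (by decide), h.antipode_eq 1 2 (by decide), h.antipode_eq 1 3 (by decide),
    h.antipode_eq 2 3 (by decide), antipode]

theorem conj_edgeForm (p₁ q₁ m₁ n₁ p₂ q₂ m₂ n₂ p₃ q₃ m₃ n₃ p₄ q₄ m₄ n₄ p₅ q₅ m₅ n₅
    p₆ q₆ m₆ n₆ : ℂ) :
    conj (edgeForm p₁ q₁ m₁ n₁ p₂ q₂ m₂ n₂ p₃ q₃ m₃ n₃ p₄ q₄ m₄ n₄ p₅ q₅ m₅ n₅ p₆ q₆ m₆ n₆) =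
      edgeForm (conj p₁) (conj q₁) (conj m₁) (conj n₁) (conj p₂) (conj q₂) (conj m₂) (conj n₂)
        (conj p₃) (conj q₃) (conj m₃) (conj n₃) (conj p₄) (conj q₄) (conj m₄) (conj n₄)
        (conj p₅) (conj q₅) (conj m₅) (conj n₅) (conj p₆) (conj q₆) (conj m₆) (conj n₆) := by
  simp only [edgeForm, map_add, map_sub, map_mul]

theorem eval_w4 (u : Fin 6 → ℝ) :
    MvPolynomial.eval u w4 =
      (u 0 ^ 2 + u 4 ^ 2) * (u 1 - u 2 - u 3 + u 5)
      + (u 1 ^ 2 + u 5 ^ 2) * (-u 0 + u 2 + u 3 - u 4)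
      + (u 2 ^ 2 + u 3 ^ 2) * (u 0 - u 1 + u 4 - u 5)
      + 2 * (u 2 * u 3 + u 4 * u 5) * (-u 0 + u 1)
      + 2 * (u 0 * u 4 + u 3 * u 5) * (-u 1 + u 2)
      + 2 * (u 1 * u 5 + u 3 * u 4) * (u 0 - u 2) := by
  simp [w4]

/-- Fourth powers appear as squares of squares so that `dist_sq_eq` can eliminate every distance. -/
theorem eval_z4 (u : Fin 6 → ℝ) :
    MvPolynomial.eval u z4 =
      u 0 ^ 2 * u 4 ^ 2 * (u 1 ^ 2 + u 2 ^ 2 + u 3 ^ 2 + u 5 ^ 2)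
      + u 1 ^ 2 * u 5 ^ 2 * (u 0 ^ 2 + u 2 ^ 2 + u 3 ^ 2 + u 4 ^ 2)
      + u 2 ^ 2 * u 3 ^ 2 * (u 0 ^ 2 + u 1 ^ 2 + u 4 ^ 2 + u 5 ^ 2)
      - ((u 0 ^ 2) ^ 2 * u 4 ^ 2 + u 0 ^ 2 * (u 4 ^ 2) ^ 2 + (u 1 ^ 2) ^ 2 * u 5 ^ 2
        + u 1 ^ 2 * (u 5 ^ 2) ^ 2 + (u 2 ^ 2) ^ 2 * u 3 ^ 2 + u 2 ^ 2 * (u 3 ^ 2) ^ 2)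
      - (u 0 ^ 2 * u 1 ^ 2 * u 3 ^ 2 + u 0 ^ 2 * u 2 ^ 2 * u 5 ^ 2
        + u 1 ^ 2 * u 2 ^ 2 * u 4 ^ 2 + u 3 ^ 2 * u 4 ^ 2 * u 5 ^ 2) := by
  simp [z4]
  ring

/-- The Cayley–Menger determinant. -/
theorem eval_z4_distVec (P : Fin 4 → E3) :
    MvPolynomial.eval (distVec P) z4 = 4 * edgeDet P ^ 2 := by
  rw [eval_z4, edgeDet_eq]
  simp only [distVec, Matrix.cons_val, dist_sq_eq]
  ring

theorem At_sub_conj {P : Fin 4 → E3} (hP : Function.Injective P) :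
    At P - conj (At P) =
      ((-4 * edgeDet P * MvPolynomial.eval (distVec P) w4 : ℝ) : ℂ) * Complex.I := by
  set ℓ := stdLift P
  have hℓ : IsNormalizedLift P ℓ := isNormalizedLift_stdLift P
  rw [At_eq_liftDet hP hℓ, liftDet_eq_edgeForm hℓ, conj_edgeForm]
  -- Conjugation fixes the two diagonal products of an edge and exchanges the off-diagonal ones.
  have e : ∀ z w : ℂ, conj (z * conj w) = w * conj z := fun z w => by simp [mul_comm]
  simp only [e]
  obtain ⟨p1, q1, m1, n1⟩ := hopf_entries (hℓ.hopf_eq 0 1 (by decide))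
  obtain ⟨p2, q2, m2, n2⟩ := hopf_entries (hℓ.hopf_eq 0 2 (by decide))
  obtain ⟨p3, q3, m3, n3⟩ := hopf_entries (hℓ.hopf_eq 0 3 (by decide))
  obtain ⟨p4, q4, m4, n4⟩ := hopf_entries (hℓ.hopf_eq 1 2 (by decide))
  obtain ⟨p5, q5, m5, n5⟩ := hopf_entries (hℓ.hopf_eq 1 3 (by decide))
  obtain ⟨p6, q6, m6, n6⟩ := hopf_entries (hℓ.hopf_eq 2 3 (by decide))
  -- The edges not through `P 0` are written as differences of edges from `P 0`, the shape required
  -- by `edgeForm_sub_edgeForm_swap`.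
  have sub_sub' : ∀ u v w : ℂ, v - u = (v - w) - (u - w) := fun u v w => by ring
  rw [sub_sub' (P 1 0) (P 2 0) (P 0 0)] at p4 q4
  rw [sub_sub' (P 1 0) (P 3 0) (P 0 0)] at p5 q5
  rw [sub_sub' (P 2 0) (P 3 0) (P 0 0)] at p6 q6
  rw [sub_sub' _ _ ⟨P 0 1, P 0 2⟩] at m4 m5 m6
  rw [sub_sub' _ _ ⟨P 0 1, -P 0 2⟩] at n4 n5 n6
  rw [p1, q1, m1, n1, p2, q2, m2, n2, p3, q3, m3, n3, p4, q4, m4, n4, p5, q5, m5, n5,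
    p6, q6, m6, n6]
  have hz : ∀ x y : ℝ, (⟨x, y⟩ : ℂ) = x + y * Complex.I := Complex.mk_eq_add_mul_I
  have hd : ∀ u v w : E3, (dist u v : ℂ) ^ 2 = (((v 0 : ℂ) - w 0) - ((u 0 : ℂ) - w 0)) ^ 2 +
      ((⟨v 1, v 2⟩ - ⟨w 1, w 2⟩) - (⟨u 1, u 2⟩ - ⟨w 1, w 2⟩)) *
        ((⟨v 1, -v 2⟩ - ⟨w 1, -w 2⟩) - (⟨u 1, -u 2⟩ - ⟨w 1, -w 2⟩)) := by
    intro u v w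
    have := congrArg (fun r : ℝ => (r : ℂ)) (dist_sq_eq u v)
    simp only [Complex.ofReal_pow] at this
    rw [this]
    simp only [hz]
    push_cast
    linear_combination ((v 2 : ℂ) - u 2) ^ 2 * Complex.I_sq
  have hd0 : ∀ u v : E3, (dist u v : ℂ) ^ 2 = ((v 0 : ℂ) - u 0) ^ 2 +
      (⟨v 1, v 2⟩ - ⟨u 1, u 2⟩) * (⟨v 1, -v 2⟩ - ⟨u 1, -u 2⟩) := by
    intro u v
    simpa using hd u v u
  rw [edgeForm_sub_edgeForm_swap (hd0 _ _) (hd0 _ _) (hd0 _ _) (hd _ _ _) (hd _ _ _) (hd _ _ _)]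
  rw [eval_w4, edgeDet_eq]
  simp only [hz, distVec, Matrix.cons_val]
  push_cast
  ring

theorem At_im {P : Fin 4 → E3} (hP : Function.Injective P) :
    (At P).im = -2 * edgeDet P * MvPolynomial.eval (distVec P) w4 := by
  have h := congrArg Complex.im (At_sub_conj hP)
  rw [Complex.im_ofReal_mul, Complex.I_im, Complex.sub_im, Complex.conj_im] at h
  linarith

/-- A tetrahedron with coinciding vertices is flat; this makes the convention At = 0 consistent with
the square formula. -/
theorem edgeDet_eq_zero_of_not_injective {P : Fin 4 → E3} (hP : ¬ Function.Injective P) :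
    edgeDet P = 0 := by
  obtain ⟨i, j, h, hij⟩ := Function.not_injective_iff.mp hP
  rw [edgeDet_eq]
  fin_cases i <;> fin_cases j <;> first
    | exact absurd rfl hij
    | (simp only [Fin.reduceFinMk, Fin.zero_eta, Fin.mk_one] at h; rw [h]; ring)

theorem At_im_sq (P : Fin 4 → E3) :
    (At P).im ^ 2 = MvPolynomial.eval (distVec P) w4 ^ 2 * MvPolynomial.eval (distVec P) z4 := by
  rw [eval_z4_distVec]
  by_cases hP : Function.Injective P
  · rw [At_im hP]
    ring
  · rw [edgeDet_eq_zero_of_not_injective hP, At, if_neg hP]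
    simp

/-! ### Symmetry and degree of the polynomials -/

theorem permuteVec_edgeIdx (σ : Equiv.Perm (Fin 4)) (u : Fin 6 → ℝ) {i j : Fin 4} (h : i ≠ j) :
    permuteVec σ u (edgeIdx i j) = u (edgeIdx (σ i) (σ j)) := by
  have hs : ∀ k l, edgeIdx k l = edgeIdx l k := by decide
  fin_cases i <;> fin_cases j <;> first | exact absurd rfl h | rfl | exact congrArg u (hs _ _)

/-- Relabelling is precomposition, hence a right action, which reverses the order of the factors. -/
theorem permuteVec_mul (σ τ : Equiv.Perm (Fin 4)) (u : Fin 6 → ℝ) :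
    permuteVec (σ * τ) u = permuteVec τ (permuteVec σ u) := by
  have h : ∀ i j : Fin 4, i ≠ j →
      permuteVec σ u (edgeIdx (τ i) (τ j)) = u (edgeIdx ((σ * τ) i) ((σ * τ) j)) :=
    fun i j hij => permuteVec_edgeIdx σ u (τ.injective.ne hij)
  rw [permuteVec.eq_def τ, h 0 3 (by decide), h 1 3 (by decide), h 2 3 (by decide),
    h 0 1 (by decide), h 1 2 (by decide), h 0 2 (by decide)]
  rfl

theorem permuteVec_one (u : Fin 6 → ℝ) : permuteVec 1 u = u := by
  ext k
  fin_cases k <;> rfl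

/-- A transposition fixes the edge it flips and the opposite edge, and exchanges the other four in
two pairs. Since transpositions generate, these six cases suffice for all symmetry claims. -/
theorem permuteVec_swap {i j : Fin 4} (h : i ≠ j) (u : Fin 6 → ℝ) :
    permuteVec (Equiv.swap i j) u = ![u 1, u 0, u 2, u 3, u 5, u 4] ∨
    permuteVec (Equiv.swap i j) u = ![u 2, u 1, u 0, u 4, u 3, u 5] ∨
    permuteVec (Equiv.swap i j) u = ![u 0, u 3, u 5, u 1, u 4, u 2] ∨
    permuteVec (Equiv.swap i j) u = ![u 0, u 2, u 1, u 5, u 4, u 3] ∨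
    permuteVec (Equiv.swap i j) u = ![u 3, u 1, u 4, u 0, u 2, u 5] ∨
    permuteVec (Equiv.swap i j) u = ![u 5, u 4, u 2, u 3, u 1, u 0] := by
  wlog hij : i < j generalizing i j
  · rw [Equiv.swap_comm]
    exact this h.symm (lt_of_le_of_ne (not_lt.mp hij) h.symm)
  fin_cases i <;> fin_cases j <;> first
    | exact absurd hij (by decide)
    | exact Or.inl rfl
    | exact Or.inr (Or.inl rfl)
    | exact Or.inr (Or.inr (Or.inl rfl))
    | exact Or.inr (Or.inr (Or.inr (Or.inl rfl)))
    | exact Or.inr (Or.inr (Or.inr (Or.inr (Or.inl rfl))))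
    | exact Or.inr (Or.inr (Or.inr (Or.inr (Or.inr rfl))))

theorem isSkewPoly_w4 : IsSkewPoly w4 := by
  intro σ
  induction σ using Equiv.Perm.swap_induction_on' with
  | one => intro u; simp [permuteVec_one]
  | mul_swap f i j hij ih =>
    intro u
    have key (v : Fin 6 → ℝ) : MvPolynomial.eval (permuteVec (Equiv.swap i j) v) w4 =
        -MvPolynomial.eval v w4 := by
      rcases permuteVec_swap hij v with h | h | h | h | h | h <;>
      · rw [h, eval_w4, eval_w4]
        simp only [Matrix.cons_val]
        ring
    rw [permuteVec_mul, Equiv.Perm.sign_mul, Equiv.Perm.sign_swap hij, key, ih]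
    push_cast
    ring

theorem isSymmPoly_z4 : IsSymmPoly z4 := by
  intro σ
  induction σ using Equiv.Perm.swap_induction_on' with
  | one => intro u; simp [permuteVec_one]
  | mul_swap f i j hij ih =>
    intro u
    have key (v : Fin 6 → ℝ) : MvPolynomial.eval (permuteVec (Equiv.swap i j) v) z4 =
        MvPolynomial.eval v z4 := by
      rcases permuteVec_swap hij v with h | h | h | h | h | h <;>
      · rw [h, eval_z4, eval_z4]
        simp only [Matrix.cons_val]
        ring
    rw [permuteVec_mul, key, ih]

theorem isSymmPoly_w4_sq_mul_z4 : IsSymmPoly (w4 ^ 2 * z4) := by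
  intro σ u
  rw [map_mul, map_pow, isSkewPoly_w4, isSymmPoly_z4, map_mul, map_pow, mul_pow]
  rcases Int.units_eq_one_or (Equiv.Perm.sign σ) with h | h <;> simp [h]

theorem isHomogeneous_w4 : w4.IsHomogeneous 3 := by
  have hX (i : Fin 6) : (MvPolynomial.X i : MvPolynomial (Fin 6) ℝ).IsHomogeneous 1 :=
    MvPolynomial.isHomogeneous_X ℝ i
  have hsq (i j : Fin 6) : (MvPolynomial.X i ^ 2 + MvPolynomial.X j ^ 2 :
      MvPolynomial (Fin 6) ℝ).IsHomogeneous 2 := ((hX i).pow 2).add ((hX j).pow 2)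
  have hmul (i j k l : Fin 6) : (2 * (MvPolynomial.X i * MvPolynomial.X j +
      MvPolynomial.X k * MvPolynomial.X l) : MvPolynomial (Fin 6) ℝ).IsHomogeneous 2 := by
    have h := ((hX i).mul (hX j)).add ((hX k).mul (hX l))
    rw [two_mul]
    exact h.add h
  exact (((((((hsq 0 4).mul ((((hX 1).sub (hX 2)).sub (hX 3)).add (hX 5))).add
    ((hsq 1 5).mul ((((hX 0).neg.add (hX 2)).add (hX 3)).sub (hX 4)))).add
    ((hsq 2 3).mul ((((hX 0).sub (hX 1)).add (hX 4)).sub (hX 5)))).add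
    ((hmul 2 3 4 5).mul ((hX 0).neg.add (hX 1)))).add
    ((hmul 0 4 3 5).mul ((hX 1).neg.add (hX 2)))).add
    ((hmul 1 5 3 4).mul ((hX 0).sub (hX 2))))

theorem isHomogeneous_z4 : z4.IsHomogeneous 6 := by
  have hp (i : Fin 6) (n : ℕ) : (MvPolynomial.X i ^ n : MvPolynomial (Fin 6) ℝ).IsHomogeneous n :=
    MvPolynomial.isHomogeneous_X_pow i n
  have h3 (i j k : Fin 6) : (MvPolynomial.X i ^ 2 * MvPolynomial.X j ^ 2 * MvPolynomial.X k ^ 2 :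
      MvPolynomial (Fin 6) ℝ).IsHomogeneous 6 := ((hp i 2).mul (hp j 2)).mul (hp k 2)
  have h4 (i j k l m n : Fin 6) : (MvPolynomial.X i ^ 2 * MvPolynomial.X j ^ 2 *
      (MvPolynomial.X k ^ 2 + MvPolynomial.X l ^ 2 + MvPolynomial.X m ^ 2 + MvPolynomial.X n ^ 2) :
      MvPolynomial (Fin 6) ℝ).IsHomogeneous 6 :=
    ((hp i 2).mul (hp j 2)).mul ((((hp k 2).add (hp l 2)).add (hp m 2)).add (hp n 2))
  have h42 (i j : Fin 6) : (MvPolynomial.X i ^ 4 * MvPolynomial.X j ^ 2 :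
      MvPolynomial (Fin 6) ℝ).IsHomogeneous 6 := (hp i 4).mul (hp j 2)
  have h24 (i j : Fin 6) : (MvPolynomial.X i ^ 2 * MvPolynomial.X j ^ 4 :
      MvPolynomial (Fin 6) ℝ).IsHomogeneous 6 := (hp i 2).mul (hp j 4)
  exact ((((h4 0 4 1 2 3 5).add (h4 1 5 0 2 3 4)).add (h4 2 3 0 1 4 5)).sub
    ((((((h42 0 4).add (h24 0 4)).add (h42 1 5)).add (h24 1 5)).add (h42 2 3)).add (h24 2 3))).sub
    ((((h3 0 1 3).add (h3 0 2 5)).add (h3 1 2 4)).add (h3 3 4 5))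

theorem isHomogeneous_w4_sq_mul_z4 : (w4 ^ 2 * z4).IsHomogeneous 12 :=
  (isHomogeneous_w4.pow 2).mul isHomogeneous_z4

/-! ### Uniqueness: a box of realizable distance vectors -/

theorem dist_eq_of_sq {u v : E3} {r : ℝ} (hr : 0 ≤ r)
    (h : (v 0 - u 0) ^ 2 + (v 1 - u 1) ^ 2 + (v 2 - u 2) ^ 2 = r ^ 2) : dist u v = r := by
  rw [← sq_eq_sq₀ dist_nonneg hr, dist_sq_eq, h]

/-- Six numbers are the distances of four points if the base triangle is roughly equilateral and
the three other edges are long and of roughly equal length. -/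
theorem exists_distVec_eq {a b c x y z : ℝ} (ha : a ∈ Set.Icc (10 : ℝ) 10.1)
    (hb : b ∈ Set.Icc (10 : ℝ) 10.1) (hc : c ∈ Set.Icc (10 : ℝ) 10.1)
    (hx : x ∈ Set.Icc (1 : ℝ) 1.1) (hy : y ∈ Set.Icc (1 : ℝ) 1.1) (hz : z ∈ Set.Icc (1 : ℝ) 1.1) :
    ∃ P : Fin 4 → E3, distVec P = ![a, b, c, x, y, z] := by
  have sq_mem {l u r : ℝ} (hl : 0 ≤ l) (h : r ∈ Set.Icc l u) : l ^ 2 ≤ r ^ 2 ∧ r ^ 2 ≤ u ^ 2 :=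
    ⟨pow_le_pow_left₀ hl h.1 2, pow_le_pow_left₀ (hl.trans h.1) h.2 2⟩
  obtain ⟨ha1, ha2⟩ := sq_mem (by norm_num) ha
  obtain ⟨hb1, hb2⟩ := sq_mem (by norm_num) hb
  obtain ⟨hc1, hc2⟩ := sq_mem (by norm_num) hc
  obtain ⟨hx1, hx2⟩ := sq_mem (by norm_num) hx
  obtain ⟨hy1, hy2⟩ := sq_mem (by norm_num) hy
  obtain ⟨hz1, hz2⟩ := sq_mem (by norm_num) hz
  have hx0 : 0 < x := lt_of_lt_of_le one_pos hx.1
  rw [one_pow] at hx1 hy1 hz1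
  norm_num at ha1 ha2 hb1 hb2 hc1 hc2 hx2 hy2 hz2
  -- The points sought are (0,0,0), (x,0,0), (p,q,0), (s,t,h). Subtracting sphere equations gives p,
  -- s and t linearly; q and h are square roots. The numerical bounds keep the radicands positive:
  -- z² - p² ≥ 1 - 0.51 and a² - s² - t² ≥ 100 - 4 - 50.
  obtain ⟨p, hp⟩ : ∃ p, p * (2 * x) = x ^ 2 + z ^ 2 - y ^ 2 :=
    ⟨_, div_mul_cancel₀ _ (by positivity)⟩
  have hp2 : p ^ 2 ≤ 0.51 := by
    have h : (p * (2 * x)) ^ 2 ≤ 1.42 ^ 2 :=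
      pow_le_pow_left₀ (by rw [hp]; linarith) (by rw [hp]; linarith) 2
    nlinarith [sq_nonneg p]
  obtain ⟨q, hq0, hq⟩ : ∃ q, 0 < q ∧ q ^ 2 = z ^ 2 - p ^ 2 :=
    ⟨_, Real.sqrt_pos.mpr (by linarith), Real.sq_sqrt (by linarith)⟩
  obtain ⟨s, hs⟩ : ∃ s, s * (2 * x) = a ^ 2 + x ^ 2 - b ^ 2 :=
    ⟨_, div_mul_cancel₀ _ (by positivity)⟩
  have hs2 : s ^ 2 ≤ 4 := by
    have h : (s * (2 * x)) ^ 2 ≤ 4 ^ 2 := sq_le_sq' (by rw [hs]; linarith) (by rw [hs]; linarith)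
    nlinarith [sq_nonneg s]
  obtain ⟨t, ht⟩ : ∃ t, t * (2 * q) = a ^ 2 + z ^ 2 - c ^ 2 - 2 * p * s :=
    ⟨_, div_mul_cancel₀ _ (by positivity)⟩
  have ht2 : t ^ 2 ≤ 50 := by
    have hps1 : 2 * p * s ≤ 5 := by nlinarith [sq_nonneg (p - s)]
    have hps2 : -5 ≤ 2 * p * s := by nlinarith [sq_nonneg (p + s)]
    have h : (t * (2 * q)) ^ 2 ≤ 9 ^ 2 := sq_le_sq' (by rw [ht]; linarith) (by rw [ht]; linarith)
    nlinarith [sq_nonneg t]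
  obtain ⟨h, hh⟩ : ∃ h, h ^ 2 = a ^ 2 - s ^ 2 - t ^ 2 :=
    ⟨_, Real.sq_sqrt (by linarith)⟩
  refine ⟨![!₂[0, 0, 0], !₂[x, 0, 0], !₂[p, q, 0], !₂[s, t, h]], ?_⟩
  have e1 := dist_eq_of_sq (u := !₂[0, 0, 0]) (v := !₂[s, t, h]) (r := a) (by linarith [ha.1])
    (by simp; linarith)
  have e2 := dist_eq_of_sq (u := !₂[x, 0, 0]) (v := !₂[s, t, h]) (r := b) (by linarith [hb.1])
    (by simp; linarith)
  have e3 := dist_eq_of_sq (u := !₂[p, q, 0]) (v := !₂[s, t, h]) (r := c) (by linarith [hc.1])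
    (by simp; linarith)
  have e4 := dist_eq_of_sq (u := !₂[0, 0, 0]) (v := !₂[x, 0, 0]) (r := x) hx0.le
    (by simp)
  have e5 := dist_eq_of_sq (u := !₂[x, 0, 0]) (v := !₂[p, q, 0]) (r := y) (by linarith [hy.1])
    (by simp; linarith)
  have e6 := dist_eq_of_sq (u := !₂[0, 0, 0]) (v := !₂[p, q, 0]) (r := z) (by linarith [hz.1])
    (by simp; linarith)
  simp only [distVec, Matrix.cons_val, e1, e2, e3, e4, e5, e6]

/-- A polynomial is determined by its values on the vectors of distances of four points. -/
theorem eq_of_eval_distVec {F G : MvPolynomial (Fin 6) ℝ}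
    (h : ∀ P : Fin 4 → E3, MvPolynomial.eval (distVec P) F = MvPolynomial.eval (distVec P) G) :
    F = G := by
  -- A polynomial is determined by its values on a product of infinite sets.
  refine MvPolynomial.funext_set
    ![Set.Icc 10 10.1, Set.Icc 10 10.1, Set.Icc 10 10.1, Set.Icc 1 1.1, Set.Icc 1 1.1, Set.Icc 1
    1.1]
    ?_ ?_
  · intro i
    fin_cases i <;> exact Set.Icc_infinite (by norm_num)
  · intro u hu
    obtain ⟨P, hP⟩ := exists_distVec_eq (hu 0 trivial) (hu 1 trivial) (hu 2 trivial)
      (hu 3 trivial) (hu 4 trivial) (hu 5 trivial)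
    have hPu : distVec P = u := by
      rw [hP]
      ext i
      fin_cases i <;> rfl
    rw [← hPu]
    exact h P

/-! ### Volume of the tetrahedron -/

/-- The simplex cut off from the nonnegative orthant by `∑ x i ≤ t`. -/
def cornerSimplex (n : ℕ) (t : ℝ) : Set (Fin n → ℝ) := {x | (∀ i, 0 ≤ x i) ∧ ∑ i, x i ≤ t}

theorem measurableSet_cornerSimplex (n : ℕ) (t : ℝ) : MeasurableSet (cornerSimplex n t) := by
  have h : cornerSimplex n t = Set.Ici 0 ∩ {x | ∑ i, x i ≤ t} := rfl
  rw [h]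
  exact (isClosed_Ici.inter (isClosed_le (by fun_prop) continuous_const)).measurableSet

/-- Fubini along the first coordinate: the slice at s in [0, t] is the corner simplex of size t - s
one dimension lower, and all other slices are empty. -/
theorem volume_cornerSimplex (n : ℕ) {t : ℝ} (ht : 0 ≤ t) :
    volume (cornerSimplex n t) = ENNReal.ofReal (t ^ n / n.factorial) := by
  induction n generalizing t with
  | zero =>
    have : cornerSimplex 0 t = Set.univ := by
      ext x
      simp [cornerSimplex, ht]
    rw [this, volume_pi, Measure.pi_of_empty _ 0]
    simp
  | succ n ih =>
    let e := MeasurableEquiv.piFinSuccAbove (fun _ : Fin (n + 1) => ℝ) 0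
    have he : MeasurePreserving e.symm :=
      (volume_preserving_piFinSuccAbove (fun _ : Fin (n + 1) => ℝ) 0).symm e
    have hslice (s : ℝ) : volume (Prod.mk s ⁻¹' (e.symm ⁻¹' cornerSimplex (n + 1) t)) =
        (Set.Icc 0 t).indicator (fun s => ENNReal.ofReal ((t - s) ^ n / n.factorial)) s := by
      have hset : Prod.mk s ⁻¹' (e.symm ⁻¹' cornerSimplex (n + 1) t) =
          {x | 0 ≤ s ∧ x ∈ cornerSimplex n (t - s)} := by
        ext x
        simp [cornerSimplex, e, Fin.forall_fin_succ, Fin.sum_univ_succ, and_assoc,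
          le_sub_iff_add_le']
      rw [hset]
      by_cases hs : s ∈ Set.Icc 0 t
      · rw [Set.indicator_of_mem hs, ← ih (sub_nonneg.mpr hs.2)]
        simp [hs.1]
      · rw [Set.indicator_of_notMem hs, ← measure_empty (μ := (volume : Measure (Fin n → ℝ)))]
        congr 1
        ext x
        simp only [cornerSimplex, Set.mem_ofPred_eq, Set.mem_empty_iff_false, iff_false]
        rintro ⟨h0, h1, h2⟩
        exact hs ⟨h0, by linarith [Finset.sum_nonneg fun i (_ : i ∈ Finset.univ) => h1 i]⟩
    rw [← he.measure_preimage (measurableSet_cornerSimplex _ _).nullMeasurableSet,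
      Measure.volume_eq_prod,
      Measure.prod_apply (e.symm.measurable (measurableSet_cornerSimplex _ _)),
      lintegral_congr hslice, lintegral_indicator measurableSet_Icc,
      ← ofReal_integral_eq_lintegral_ofReal]
    · rw [integral_Icc_eq_integral_Ioc, ← intervalIntegral.integral_of_le ht,
        intervalIntegral.integral_div,
        intervalIntegral.integral_comp_sub_left (fun s => s ^ n) t, integral_pow,
        Nat.factorial_succ]
      congr 1
      push_cast
      field_simp
      simp
    · exact Continuous.integrableOn_Icc (by fun_prop)
    · refine (ae_restrict_iff' measurableSet_Icc).mpr (Filter.Eventually.of_forall fun s hs => ?_)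
      have : 0 ≤ t - s := sub_nonneg.mpr hs.2
      simp only [Pi.zero_apply]
      positivity

/-- Dropping the barycentric weight of `P 0` presents the tetrahedron as an affine image of the
corner simplex. The preimage under `WithLp.ofLp` moves the question to the product measure on `Fin 3
→ ℝ`. -/
theorem convexHull_range_eq (P : Fin 4 → E3) :
    convexHull ℝ (Set.range P) = WithLp.ofLp ⁻¹' ((fun x => WithLp.ofLp (P 0) + x) ''
      (Matrix.toLin' (Matrix.of fun k i : Fin 3 => (P i.succ - P 0) k) '' cornerSimplex 3 1)) := by
  have h : convexHull ℝ (Set.range P) =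
      (fun w : Fin 4 → ℝ => ∑ i, w i • P i) '' stdSimplex ℝ (Fin 4) := by
    have hf : (fun w : Fin 4 → ℝ => ∑ i, w i • P i) = Fintype.linearCombination ℝ P := by
      ext1 w
      rw [Fintype.linearCombination_apply]
    rw [hf, ← convexHull_rangle_single_eq_stdSimplex, LinearMap.image_convexHull, ← Set.range_comp]
    congr 2
    ext1 i
    simp [Fintype.linearCombination_apply_single]
  rw [h]
  ext v
  constructor
  · rintro ⟨w, ⟨hw0, hw1⟩, rfl⟩
    rw [Fin.sum_univ_succ] at hw1
    refine ⟨_, ⟨fun i => w i.succ, ⟨fun i => hw0 _, by linarith [hw0 0]⟩, rfl⟩, ?_⟩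
    ext k
    simp [Matrix.mulVec, dotProduct, Fin.sum_univ_succ] at hw1 ⊢
    linear_combination (-P 0 k) * hw1
  · rintro ⟨_, ⟨x, ⟨hx0, hx1⟩, rfl⟩, hv⟩
    refine ⟨Fin.cons (1 - ∑ i, x i) x, ⟨?_, ?_⟩, ?_⟩
    · intro i
      refine Fin.cases ?_ ?_ i
      · simpa using hx1
      · simpa using hx0
    · simp [Fin.sum_univ_succ]
    · ext k
      have := congrFun hv k
      simp [Matrix.mulVec, dotProduct, Fin.sum_univ_succ] at this ⊢
      linear_combination this

theorem tetVolume_eq (P : Fin 4 → E3) : tetVolume P = |edgeDet P| / 6 := by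
  have h := (EuclideanSpace.volume_preserving_symm_measurableEquiv_toLp
    (Fin 3)).measure_preimage_equiv
    ((fun x => WithLp.ofLp (P 0) + x) ''
      (Matrix.toLin' (Matrix.of fun k i : Fin 3 => (P i.succ - P 0) k) '' cornerSimplex 3 1))
  -- Translation preserves volume and the linear map scales it by |det|. The transpose is needed
  -- because the edge vectors are the columns here but the rows in `edgeDet`.
  rw [Set.image_add_left, measure_preimage_add, Measure.addHaar_image_linearMap,
    LinearMap.det_toLin', volume_cornerSimplex 3 zero_le_one, ← ENNReal.ofReal_mul (abs_nonneg _),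
    ← Matrix.det_transpose, ← Set.image_add_left] at h
  rw [tetVolume, Measure.real, convexHull_range_eq]
  refine (congrArg ENNReal.toReal h).trans ?_
  rw [ENNReal.toReal_ofReal (by positivity), show Nat.factorial 3 = 6 from rfl]
  change |edgeDet P| * (1 ^ 3 / (6 : ℕ)) = _
  norm_num
  ring

/-! ### Configurations symmetric about a plane -/

theorem edgeDet_eq_basisFun_det (P : Fin 4 → E3) :
    edgeDet P = (EuclideanSpace.basisFun (Fin 3) ℝ).toBasis.det fun i : Fin 3 => P i.succ - P 0 :=
    by
  rw [edgeDet, ← Matrix.det_transpose, Module.Basis.det_apply]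
  congr 1

theorem edgeDet_comp_perm (P : Fin 4 → E3) (σ : Equiv.Perm (Fin 4)) :
    edgeDet (P ∘ σ) = (Equiv.Perm.sign σ : ℤ) * edgeDet P := by
  -- With a column of ones added, all four points play the same role, and relabelling permutes the
  -- rows.
  have h (Q : Fin 4 → E3) :
      edgeDet Q = (Matrix.of fun i : Fin 4 => ![1, Q i 0, Q i 1, Q i 2]).det := by
    rw [edgeDet_eq, Matrix.det_succ_row_zero]
    simp [Fin.sum_univ_succ, Matrix.det_fin_three, Fin.succAbove]
    ring
  rw [h, h, ← Matrix.det_permute]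
  rfl

/-- The edge vectors are moved by the linear reflection, whose determinant is -1 to the dimension of
the orthogonal complement, here 1. -/
theorem edgeDet_reflection (P : Fin 4 → E3) (S : AffineSubspace ℝ E3) [Nonempty S]
    (hS : Module.finrank ℝ S.direction = 2) :
    edgeDet (EuclideanGeometry.reflection S ∘ P) = -edgeDet P := by
  have hK : Module.finrank ℝ S.directionᗮ = 1 := by
    have := S.direction.finrank_add_finrank_orthogonal
    rw [finrank_euclideanSpace_fin, hS] at this
    omega
  have h : (fun i : Fin 3 => (EuclideanGeometry.reflection S ∘ P) i.succ -
      (EuclideanGeometry.reflection S ∘ P) 0) =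
      S.direction.reflection.toLinearMap ∘ fun i : Fin 3 => P i.succ - P 0 := by
    ext1 i
    simp only [Function.comp_apply, EuclideanGeometry.reflection_apply, vadd_eq_add, vsub_eq_sub,
      add_sub_add_right_eq_sub]
    rw [← map_sub, sub_sub_sub_cancel_right]
    rfl
  rw [edgeDet_eq_basisFun_det, h, Module.Basis.det_comp, Submodule.det_reflection, hK,
    ← edgeDet_eq_basisFun_det]
  ring

theorem distVec_isometry_comp {f : E3 → E3} (hf : Isometry f) (P : Fin 4 → E3) :
    distVec (f ∘ P) = distVec P := by
  simp only [distVec, Function.comp_apply, hf.dist_eq]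

theorem At_im_eq_zero_of_reflection (P : Fin 4 → E3) (S : AffineSubspace ℝ E3) [Nonempty S]
    (hS : Module.finrank ℝ S.direction = 2)
    (hP : EuclideanGeometry.reflection S '' Set.range P = Set.range P) : (At P).im = 0 := by
  by_cases hinj : Function.Injective P
  swap
  · rw [At, if_neg hinj, Complex.zero_im]
  have hmem : ∀ i, ∃ j, P j = EuclideanGeometry.reflection S (P i) := by
    intro i
    have h := Set.mem_image_of_mem (EuclideanGeometry.reflection S) (Set.mem_range_self (f := P) i)
    rwa [hP] at h
  choose f hf using hmem
  have hfinj : Function.Injective f := fun i j hij =>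
    hinj ((EuclideanGeometry.reflection S).injective (by rw [← hf, ← hf, hij]))
  let σ : Equiv.Perm (Fin 4) := Equiv.ofBijective f (Finite.injective_iff_bijective.mp hfinj)
  have hσ : P ∘ σ = EuclideanGeometry.reflection S ∘ P := funext hf
  have hT : edgeDet P * (Equiv.Perm.sign σ : ℤ) = -edgeDet P := by
    rw [← edgeDet_reflection P S hS, ← hσ, edgeDet_comp_perm, mul_comm]
  have hw : MvPolynomial.eval (distVec P) w4 =
      (Equiv.Perm.sign σ : ℤ) * MvPolynomial.eval (distVec P) w4 := by
    rw [← isSkewPoly_w4, ← distVec_comp_perm, hσ,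
      distVec_isometry_comp (EuclideanGeometry.reflection S).isometry]
  rw [At_im hinj]
  -- With T = `edgeDet P` and w the value of w₄: T w = T (sign σ) w = -T w, with no case split on
  -- the sign.
  linear_combination -edgeDet P * hw - MvPolynomial.eval (distVec P) w4 * hT

end FourPointAtiyah

theorem mainTheorem3 :
    -- the square of the imaginary part of the determinant is `w₄(u)² z₄(u)`
    (∀ P : Fin 4 → E3,
      (At P).im ^ 2 =
        MvPolynomial.eval (distVec P) w4 ^ 2 * MvPolynomial.eval (distVec P) z4) ∧
    -- `w₄² z₄` is the only polynomial in the distances that represents this square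
    (∀ F : MvPolynomial (Fin 6) ℝ,
      (∀ P : Fin 4 → E3, (At P).im ^ 2 = MvPolynomial.eval (distVec P) F) → F = w4 ^ 2 * z4) ∧
    -- it is symmetric and homogeneous of degree 12, and `w₄` is a skew-symmetric cubic form
    IsSymmPoly (w4 ^ 2 * z4) ∧ (w4 ^ 2 * z4).IsHomogeneous 12 ∧
    IsSkewPoly w4 ∧ w4.IsHomogeneous 3 ∧
    -- `z₄(u) = 144 V²`
    (∀ P : Fin 4 → E3, MvPolynomial.eval (distVec P) z4 = 144 * tetVolume P ^ 2) ∧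
    -- the imaginary part vanishes if the set of points is symmetric about a plane
    (∀ (P : Fin 4 → E3) (S : AffineSubspace ℝ E3) [Nonempty S],
      Module.finrank ℝ S.direction = 2 →
      EuclideanGeometry.reflection S '' Set.range P = Set.range P →
      (At P).im = 0) :=
  ⟨At_im_sq,
    fun F hF => eq_of_eval_distVec fun P => by
      rw [← hF P, At_im_sq P, map_mul, map_pow],
    isSymmPoly_w4_sq_mul_z4, isHomogeneous_w4_sq_mul_z4, isSkewPoly_w4, isHomogeneous_w4,
    fun P => by
      rw [eval_z4_distVec, tetVolume_eq, div_pow, sq_abs]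
      ring,
    fun P S _ => At_im_eq_zero_of_reflection P S⟩
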